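/- Let $\mathfrak X$ be the set of $C^\infty$ vector fields $X:\mathbb R^2\to\mathbb R^2$ with the $C^2$ Whitney (strong) topology, in which a basis of neighbourhoods of $X$ is given by the sets of all $Z\in\mathfrak X$ with $\|D^j(Z-X)(p)\|<\varepsilon(p)$ for all $p\in\mathbb R^2$ and $j\in\{0,1,2\}$, where $\varepsilon:\mathbb R^2\to(0,\infty)$ is continuous. Let $\mathfrak X\times\mathfrak X$ have the product topology. A property of pairs $(X,Y)\in\mathfrak X\times\mathfrak X$ is called generic if it holds on a residual subset, that is, on a dense subset of $\mathfrak X\times\mathfrak X$ which is a countable intersection of open dense subsets. Write $\mathcal Z_X=\{p: X(p)=0\}$. The bisector line field of $(X,Y)$ is the map $$\mathrm B(X,Y):D=\mathbb R^2\setminus(\mathcal Z_X\cup\mathcal Z_Y)\to\mathbb R/\pi\mathbb Z,\qquad \mathrm B(X,Y)(p)=\tfrac12\bigl(\theta_X(p)+\theta_Y(p)\bigr)\pmod\pi,$$ where $X(p)=\|X(p)\|(\cos\theta_X(p),\sin\theta_X(p))$ and $Y(p)=\|Y(p)\|(\cos\theta_Y(p),\sin\theta_Y(p))$. A map $L:D\to\mathbb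 R/\pi\mathbb Z$ with $D\subseteq\mathbb R^2$ is singular at $p\in\overline D\setminus D$ if it cannot be uniquely continuously extended at $p$. Such a singularity is called isolated if there is an open set $V\subseteq\mathbb R^2$ with $p\in V$ and $V=\{p\}\cup(V\cap D)$. The index of $L$ at $p$ is the number $i$ such that, for all sufficiently small $r>0$, the circle of centre $p$ and radius $r$ lies in $D$ and $\theta(2\pi)-\theta(0)=2\pi i$ for a continuous $\theta:[0,2\pi]\to\mathbb R$ with $\theta(t)\bmod\pi=L(p+r(\cos t,\sin t))$ for all $t$. **Proposition.** For a generic pair $(X,Y)$ of smooth vector fields, $\mathrm B(X,Y)$ is continuous on $\mathbb R^2\setminus(\mathcal Z_X\cup\mathcal Z_Y)$, every singularity of $\mathrm B(X,Y)$ is isolated, and every singularity of $\mathrm B(X,Y)$ has index $\frac12$ or $-\frac12$. -/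

import Mathlib

open scoped ContDiff

namespace BisectorLineField

/-- The Euclidean plane `ℝ²`. -/
abbrev Plane : Type := EuclideanSpace ℝ (Fin 2)

/-- The orientation set: `[0, π]` with `0` and `π` identified, that is `ℝ / πℤ`. -/
abbrev OrientationSet : Type := AddCircle Real.pi

/-- A smooth (`C^∞`) vector field on the plane. -/
@[ext]
structure SmoothVectorField where
  toFun : Plane → Plane
  smooth : ContDiff ℝ ∞ toFun

namespace SmoothVectorField

instance : CoeFun SmoothVectorField (fun _ => Plane → Plane) := ⟨toFun⟩

/-- The zero set of a vector field. -/
def zeroSet (X : SmoothVectorField) : Set Plane := {p | X p = 0}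

/-- The basic neighbourhood of `X` in the `C^k` Whitney (strong) topology given by the
function `ε`: the fields all of whose derivatives of order at most `k` differ from those of `X`
by less than `ε p` at each point `p` of the plane. -/
def whitneyNhd (k : ℕ) (X : SmoothVectorField) (ε : Plane → ℝ) : Set SmoothVectorField :=
  {Z | ∀ p : Plane, ∀ j : ℕ, j ≤ k →
    ‖iteratedFDeriv ℝ j (fun q => Z q - X q) p‖ < ε p}

/-- The `C^k` Whitney (strong) topology on the set of smooth vector fields: the sets
`whitneyNhd k X ε`, with `ε` a positive continuous function, form a basis of neighbourhoods
of `X`. -/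
abbrev whitneyTopology (k : ℕ) : TopologicalSpace SmoothVectorField where
  IsOpen U := ∀ X ∈ U, ∃ ε : Plane → ℝ, Continuous ε ∧ (∀ p, 0 < ε p) ∧ whitneyNhd k X ε ⊆ U
  isOpen_univ := fun _ _ => ⟨fun _ => 1, continuous_const, fun _ => one_pos, Set.subset_univ _⟩
  isOpen_inter := by
    rintro U V hU hV X ⟨hXU, hXV⟩
    obtain ⟨ε, hε, hε0, hεU⟩ := hU X hXU
    obtain ⟨δ, hδ, hδ0, hδV⟩ := hV X hXV
    refine ⟨fun p => min (ε p) (δ p), hε.min hδ, fun p => lt_min (hε0 p) (hδ0 p), ?_⟩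
    intro Z hZ
    exact ⟨hεU fun p j hj => (hZ p j hj).trans_le (min_le_left _ _),
      hδV fun p j hj => (hZ p j hj).trans_le (min_le_right _ _)⟩
  isOpen_sUnion := by
    rintro S hS X ⟨U, hU, hXU⟩
    obtain ⟨ε, hε, hε0, hεU⟩ := hS U hU X hXU
    exact ⟨ε, hε, hε0, hεU.trans (Set.subset_sUnion_of_mem hU)⟩

/-- Smooth vector fields carry the `C^2` Whitney topology, and pairs of smooth vector fields the
resulting product topology. -/
instance : TopologicalSpace SmoothVectorField := whitneyTopology 2

end SmoothVectorField

/-- `P` is generic if it holds on a residual subset, that is on a dense set which is a countable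
intersection of open dense sets. (The density of the intersection is part of the notion: it is
not automatic in a space that need not be a Baire space.) -/
def IsGeneric {α : Type*} [TopologicalSpace α] (P : α → Prop) : Prop :=
  ∃ U : ℕ → Set α, (∀ n, IsOpen (U n)) ∧ (∀ n, Dense (U n)) ∧ Dense (⋂ n, U n) ∧
    ∀ x ∈ ⋂ n, U n, P x

/-- An orientation field: a map from a subset of the plane to the orientation set. -/
structure OrientationField where
  domain : Set Plane
  toFun : domain → OrientationSet

namespace OrientationField

/-- `L` is singular at the point `p` of `closure D \ D`, where `D` is its domain, if it cannot be
uniquely continuously extended at `p`. -/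
def IsSingularAt (L : OrientationField) (p : Plane) : Prop :=
  p ∈ closure L.domain \ L.domain ∧
    ¬ ∃! l : OrientationSet,
      Filter.Tendsto L.toFun (Filter.comap Subtype.val (nhds p)) (nhds l)

/-- The singularity `p` is isolated: `p` has an open neighbourhood `V` with
`V = {p} ∪ (V ∩ D)`, where `D` is the domain of `L`. In particular, `V` contains no other
singularity, since these lie outside `D`. -/
def IsIsolatedSingularity (L : OrientationField) (p : Plane) : Prop :=
  L.IsSingularAt p ∧ ∃ V : Set Plane, IsOpen V ∧ V = {p} ∪ (V ∩ L.domain)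

/-- The point of the circle of centre `p` and radius `r` at the angle `t`. -/
noncomputable def circlePoint (p : Plane) (r t : ℝ) : Plane :=
  p + r • !₂[Real.cos t, Real.sin t]

/-- `L` has index `i` at `p`: for every sufficiently small radius `r > 0`, the circle of centre
`p` and radius `r` lies in the domain of `L`, and along this circle, run through once
counterclockwise, a continuous real angle function `θ` of `L` varies by `2πi` in total. -/
def HasIndexAt (L : OrientationField) (p : Plane) (i : ℝ) : Prop :=
  ∃ ρ : ℝ, 0 < ρ ∧ ∀ r : ℝ, 0 < r → r < ρ →
    ∃ θ : ℝ → ℝ, ContinuousOn θ (Set.Icc 0 (2 * Real.pi)) ∧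
      (∀ t ∈ Set.Icc (0 : ℝ) (2 * Real.pi),
        ∃ h : circlePoint p r t ∈ L.domain,
          L.toFun ⟨circlePoint p r t, h⟩ = ((θ t : ℝ) : OrientationSet)) ∧
      θ (2 * Real.pi) - θ 0 = 2 * Real.pi * i

end OrientationField

/-- An angle of a nonzero vector `v`: a real number `θ` with `v = ‖v‖ (cos θ, sin θ)`, taken in
`(-π, π]`. -/
noncomputable def angle (v : Plane) : ℝ := Complex.arg ⟨v 0, v 1⟩

/-- The bisector line field of `(X, Y)`: on the set of points where neither `X` nor `Y` vanishes,
half of the sum of the angles of `X` and `Y`, modulo `π`. As another choice of either angle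
changes half of the sum by a multiple of `π`, the value does not depend on these choices. -/
noncomputable def bisector (X Y : SmoothVectorField) : OrientationField where
  domain := (X.zeroSet ∪ Y.zeroSet)ᶜ
  toFun := fun p => (((angle (X p) + angle (Y p)) / 2 : ℝ) : OrientationSet)

end BisectorLineField

/-! One open dense set suffices: `regularPairs`, the pairs with simple zeros and no common zero. It
is open because its conditions restrict the values and first derivatives at each point to avoid a
closed set, and a positive continuous `ε` measures the room left. For density, take `η > 0` smooth
with tiny derivatives. The field `X + η c` vanishes exactly where `X / η = -c`, so Sard's theorem
gives a small `c` making all its zeros simple. The second field is perturbed likewise, also avoiding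
the countably many values that would create a common zero. At a point where the bisector is
undefined, exactly one field of a regular pair vanishes. Its linear part is dominated by `α z` or `β
z̄`, so its argument varies by `±2π` on small circles (`hasArgVariationAt_of_simple_zero`), while
that of the other field varies by `0`. Half of the sum is `±π`, that is, index `±1/2`. -/

namespace BisectorLineField

/-! ### Positive smooth functions with small derivatives -/

section SmallFunctions

variable {E : Type*} [NormedAddCommGroup E] [NormedSpace ℝ E]

theorem exists_bound_iteratedFDeriv {f : E → ℝ} (hf : ContDiff ℝ ∞ f)
    (hc : HasCompactSupport f) (n : ℕ) :
    ∃ M : ℝ, 0 < M ∧ ∀ j ≤ n, ∀ x, ‖iteratedFDeriv ℝ j f x‖ ≤ M := by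
  have h : ∀ j : ℕ, ∃ C, ∀ x, ‖iteratedFDeriv ℝ j f x‖ ≤ C := fun j =>
    (hf.continuous_iteratedFDeriv (m := j) (mod_cast le_top)).bounded_above_of_compact_support
      (hc.iteratedFDeriv j)
  choose C hC using h
  refine ⟨1 + ∑ j ∈ Finset.range (n + 1), |C j|, by positivity, fun j hj x => ?_⟩
  have h1 : |C j| ≤ ∑ j ∈ Finset.range (n + 1), |C j| :=
    Finset.single_le_sum (f := fun j => |C j|) (fun _ _ => abs_nonneg _)
      (Finset.mem_range.2 (by omega))
  linarith [hC j x, le_abs_self (C j)]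

/-- A positive smooth function all of whose derivatives of order at most `k` are smaller than a
given positive continuous function. -/
theorem exists_contDiff_pos_iteratedFDeriv_lt [FiniteDimensional ℝ E] {ε : E → ℝ}
    (hε : Continuous ε) (hε0 : ∀ p, 0 < ε p) (k : ℕ) :
    ∃ η : E → ℝ, ContDiff ℝ ∞ η ∧ (∀ p, 0 < η p) ∧
      ∀ p, ∀ j ≤ k, ‖iteratedFDeriv ℝ j η p‖ < ε p := by
  let b : ℕ → ContDiffBump (0 : E) := fun n =>
    { rIn := n + 1
      rOut := n + 2
      rIn_pos := by positivity
      rIn_lt_rOut := by linarith }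
  have hb : ∀ n, ContDiff ℝ ∞ (b n) := fun n => (b n).contDiff
  have hbc : ∀ n, HasCompactSupport (b n) := fun n => (b n).hasCompactSupport
  -- Orders up to `n` make the series smooth, since each fixed order is controlled for almost all
  -- `n`; orders up to `k` give the comparison with `ε`.
  choose M hM0 hM using fun n => exists_bound_iteratedFDeriv (hb n) (hbc n) (max n k)
  have hm : ∀ n : ℕ, ∃ m : ℝ, 0 < m ∧ m ≤ 1 ∧ ∀ p ∈ tsupport (b n), m ≤ ε p := by
    intro n
    obtain ⟨q, -, hq⟩ := IsCompact.exists_isMinOn (hbc n)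
      ⟨0, subset_tsupport _ (by
        rw [(b n).support_eq]; exact Metric.mem_ball_self (b n).rOut_pos)⟩ hε.continuousOn
    exact ⟨min 1 (ε q), lt_min one_pos (hε0 q), min_le_left _ _,
      fun p hp => (min_le_right _ _).trans (hq hp)⟩
  choose m hm0 hm1 hmε using hm
  -- The weights add up to `1/2`, so the sum of the bounds is `ε p / 2`, strictly below `ε p`.
  let v : ℕ → ℝ := fun n => (1 / 4) * (1 / 2) ^ n
  have hv : HasSum v (1 / 2) := by
    have := (hasSum_geometric_of_lt_one (r := 1 / 2) (by norm_num) (by norm_num)).mul_left (1 / 4)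
    norm_num at this
    simpa [v] using this
  have hv0 : ∀ n, 0 < v n := fun n => by positivity
  let a : ℕ → ℝ := fun n => v n * m n / M n
  have ha0 : ∀ n, 0 < a n := fun n => div_pos (mul_pos (hv0 n) (hm0 n)) (hM0 n)
  let f : ℕ → E → ℝ := fun n p => a n • b n p
  have hf : ∀ n, ContDiff ℝ ∞ (f n) := fun n => (hb n).const_smul (a n)
  have hfd : ∀ n j p, ‖iteratedFDeriv ℝ j (f n) p‖ = a n * ‖iteratedFDeriv ℝ j (b n) p‖ := by
    intro n j p
    rw [show f n = fun p => a n • b n p from rfl,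
      iteratedFDeriv_const_smul_apply' ((hb n).contDiffAt.of_le (mod_cast le_top)), norm_smul,
      Real.norm_of_nonneg (ha0 n).le]
  have hbound : ∀ n j, j ≤ max n k → ∀ p, ‖iteratedFDeriv ℝ j (f n) p‖ ≤ v n * m n := by
    intro n j hj p
    rw [hfd]
    calc a n * ‖iteratedFDeriv ℝ j (b n) p‖ ≤ a n * M n := by
          gcongr
          · exact (ha0 n).le
          · exact hM n j hj p
      _ = v n * m n := div_mul_cancel₀ _ (hM0 n).ne'
  have hbound1 : ∀ n j, j ≤ max n k → ∀ p, ‖iteratedFDeriv ℝ j (f n) p‖ ≤ v n := fun n j hj p =>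
    (hbound n j hj p).trans (mul_le_of_le_one_right (hv0 n).le (hm1 n))
  have hboundε : ∀ n j, j ≤ k → ∀ p, ‖iteratedFDeriv ℝ j (f n) p‖ ≤ v n * ε p := by
    intro n j hj p
    by_cases hp : p ∈ tsupport (b n)
    · exact (hbound n j (hj.trans (le_max_right _ _)) p).trans
        (mul_le_mul_of_nonneg_left (hmε n p hp) (hv0 n).le)
    · have : iteratedFDeriv ℝ j (b n) p = 0 := by
        by_contra h
        exact hp (support_iteratedFDeriv_subset j h)
      rw [hfd, this, norm_zero, mul_zero]
      exact (mul_pos (hv0 n) (hε0 p)).le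
  refine ⟨fun p => ∑' n, f n p, ?_, fun p => ?_, fun p j hj => ?_⟩
  · refine contDiff_tsum_of_eventually (v := fun _ => v) hf (fun _ _ => hv.summable) ?_
    intro j _
    rw [Nat.cofinite_eq_atTop]
    filter_upwards [Filter.eventually_ge_atTop j] with n hn
    exact hbound1 n j (hn.trans (le_max_left _ _))
  · obtain ⟨n, hn⟩ := exists_nat_gt ‖p‖
    have hs : Summable fun n => f n p := by
      refine Summable.of_norm_bounded hv.summable fun n => ?_
      simpa using hbound1 n 0 (Nat.zero_le _) p
    refine hs.tsum_pos (fun n => mul_nonneg (ha0 n).le (b n).nonneg) n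
      (mul_pos (ha0 n) ((b n).pos_of_mem_ball ?_))
    rw [mem_ball_zero_iff]
    change ‖p‖ < (n : ℝ) + 2
    linarith
  · rw [iteratedFDeriv_tsum (N := (k : ℕ∞)) (v := fun _ => v)
      (fun n => (hf n).of_le (mod_cast le_top)) (fun _ _ => hv.summable)
      (fun i n x hi => hbound1 n i ((Nat.cast_le.1 hi).trans (le_max_right _ _)) x)
      (Nat.cast_le.2 hj)]
    refine (tsum_of_norm_bounded (hv.mul_right (ε p)) fun n => hboundε n j hj p).trans_lt ?_
    linarith [hε0 p]

end SmallFunctions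

/-! ### Open conditions in the Whitney topology -/

namespace SmoothVectorField

theorem differentiable (X : SmoothVectorField) : Differentiable ℝ X :=
  X.smooth.differentiable (by simp)

/-- A member `Z` leaves the continuous positive slack `ε - ‖D^j (Z - X)‖` for each `j ≤ 2`; the
least of the three is an admissible radius at `Z`. -/
theorem isOpen_whitneyNhd (X : SmoothVectorField) {ε : Plane → ℝ} (hε : Continuous ε) :
    IsOpen (whitneyNhd 2 X ε) := by
  intro Z hZ
  have hsub : ∀ V W : SmoothVectorField, ContDiff ℝ ∞ (fun q => V q - W q) := fun V W =>
    V.smooth.sub W.smooth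
  let g : ℕ → Plane → ℝ := fun j p => ε p - ‖iteratedFDeriv ℝ j (fun q => Z q - X q) p‖
  have hg : ∀ j, Continuous (g j) := fun j =>
    hε.sub ((hsub Z X).continuous_iteratedFDeriv (m := j) (mod_cast le_top)).norm
  have hg0 : ∀ j ≤ 2, ∀ p, 0 < g j p := fun j hj p => sub_pos.2 (hZ p j hj)
  refine ⟨fun p => min (g 0 p) (min (g 1 p) (g 2 p)), (hg 0).min ((hg 1).min (hg 2)),
    fun p => lt_min (hg0 0 (by norm_num) p)
      (lt_min (hg0 1 (by norm_num) p) (hg0 2 le_rfl p)), ?_⟩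
  intro V hV p j hj
  have h1 : ‖iteratedFDeriv ℝ j (fun q => V q - Z q) p‖ < g j p := by
    refine (hV p j hj).trans_le ?_
    interval_cases j
    · exact min_le_left _ _
    · exact (min_le_right _ _).trans (min_le_left _ _)
    · exact (min_le_right _ _).trans (min_le_right _ _)
  have h2 : (fun q => V q - X q) = (fun q => V q - Z q) + fun q => Z q - X q := by
    ext1 q
    simp
  rw [h2, iteratedFDeriv_add_apply ((hsub V Z).contDiffAt.of_le (mod_cast le_top))
    ((hsub Z X).contDiffAt.of_le (mod_cast le_top))]
  refine (norm_add_le _ _).trans_lt ?_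
  have : g j p = ε p - ‖iteratedFDeriv ℝ j (fun q => Z q - X q) p‖ := rfl
  linarith

theorem mem_whitneyNhd_self (k : ℕ) (X : SmoothVectorField) {ε : Plane → ℝ}
    (hε : ∀ p, 0 < ε p) : X ∈ whitneyNhd k X ε := by
  intro p j _
  have : (fun q => X q - X q) = fun _ => (0 : Plane) := by
    ext1 q
    simp
  rw [this, iteratedFDeriv_fun_zero, Pi.zero_apply, norm_zero]
  exact hε p

theorem norm_sub_lt_of_mem_whitneyNhd {k : ℕ} {X Z : SmoothVectorField} {ε : Plane → ℝ}
    (h : Z ∈ whitneyNhd k X ε) (p : Plane) : ‖Z p - X p‖ < ε p := by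
  simpa using h p 0 (Nat.zero_le _)

theorem norm_fderiv_sub_lt_of_mem_whitneyNhd {k : ℕ} (hk : 1 ≤ k) {X Z : SmoothVectorField}
    {ε : Plane → ℝ} (h : Z ∈ whitneyNhd k X ε) (p : Plane) :
    ‖fderiv ℝ Z p - fderiv ℝ X p‖ < ε p := by
  have := h p 1 hk
  rwa [norm_iteratedFDeriv_one, fderiv_fun_sub (Z.differentiable p) (X.differentiable p)] at this

/-- All the zeros of the vector field are simple. -/
def HasSimpleZeros (X : SmoothVectorField) : Prop :=
  ∀ p, X p = 0 → (fderiv ℝ X p).det ≠ 0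

theorem isOpen_hasSimpleZeros : IsOpen {X : SmoothVectorField | X.HasSimpleZeros} := by
  intro X hX
  let S : Set (Plane × (Plane →L[ℝ] Plane)) := {x | x.1 = 0 ∧ x.2.det = 0}
  have hS : IsClosed S := (isClosed_eq continuous_fst continuous_const).inter
    (isClosed_eq (ContinuousLinearMap.continuous_det.comp continuous_snd) continuous_const)
  -- `Metric.infDist` to the empty set is `0`, so positivity of the distance needs a point of `S`.
  have hS0 : S.Nonempty := by
    refine ⟨0, rfl, ?_⟩
    change LinearMap.det (0 : Plane →ₗ[ℝ] Plane) = 0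
    rw [LinearMap.det_zero]
    simp
  have hJ : Continuous fun p => (X p, fderiv ℝ X p) :=
    X.smooth.continuous.prodMk (X.smooth.continuous_fderiv (by simp))
  refine ⟨fun p => Metric.infDist (X p, fderiv ℝ X p) S,
    (Metric.continuous_infDist_pt S).comp hJ, fun p => ?_, ?_⟩
  · exact (hS.notMem_iff_infDist_pos hS0).1 fun h => hX p h.1 h.2
  · intro Z hZ p hp hd
    have hmem : (Z p, fderiv ℝ Z p) ∈ S := ⟨hp, hd⟩
    refine (Metric.infDist_le_dist_of_mem (x := (X p, fderiv ℝ X p)) hmem).not_gt ?_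
    rw [dist_comm, Prod.dist_eq, dist_eq_norm, dist_eq_norm]
    exact max_lt (norm_sub_lt_of_mem_whitneyNhd hZ p)
      (norm_fderiv_sub_lt_of_mem_whitneyNhd one_le_two hZ p)

theorem isOpen_no_common_zero :
    IsOpen {P : SmoothVectorField × SmoothVectorField | ∀ p, P.1 p = 0 → P.2 p ≠ 0} := by
  rw [isOpen_prod_iff]
  intro X Y hXY
  -- A common zero of nearby fields at `p` would force `‖X p‖ + ‖Y p‖ < 2 ε p`.
  let ε : Plane → ℝ := fun p => (‖X p‖ + ‖Y p‖) / 2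
  have hε : Continuous ε := by
    have := X.smooth.continuous
    have := Y.smooth.continuous
    fun_prop
  have hε0 : ∀ p, 0 < ε p := by
    intro p
    by_cases h : X p = 0
    · have := norm_pos_iff.2 (hXY p h)
      positivity
    · have := norm_pos_iff.2 h
      positivity
  refine ⟨_, _, isOpen_whitneyNhd X hε, isOpen_whitneyNhd Y hε, mem_whitneyNhd_self _ _ hε0,
    mem_whitneyNhd_self _ _ hε0, ?_⟩
  rintro ⟨V, W⟩ ⟨hV, hW⟩ p hVp hWp
  have h1 := norm_sub_lt_of_mem_whitneyNhd hV p
  have h2 := norm_sub_lt_of_mem_whitneyNhd hW p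
  simp only at hVp hWp
  rw [hVp, zero_sub, norm_neg] at h1
  rw [hWp, zero_sub, norm_neg] at h2
  simp only [ε] at h1 h2
  linarith

/-! ### Density by perturbation and Sard's theorem -/

/-- The vector field `X + η c`, for a smooth function `η` and a vector `c`. -/
def perturb (X : SmoothVectorField) (η : Plane → ℝ) (hη : ContDiff ℝ ∞ η) (c : Plane) :
    SmoothVectorField where
  toFun p := X p + η p • c
  smooth := X.smooth.add (hη.smul contDiff_const)

theorem perturb_mem_whitneyNhd (X : SmoothVectorField) {k : ℕ} {η ε : Plane → ℝ}
    (hη : ContDiff ℝ ∞ η) (h : ∀ p, ∀ j ≤ k, ‖iteratedFDeriv ℝ j η p‖ < ε p) {c : Plane}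
    (hc : ‖c‖ ≤ 1) : X.perturb η hη c ∈ whitneyNhd k X ε := by
  intro p j hj
  have h1 : (fun q => X.perturb η hη c q - X q) = fun q => η q • c := by
    ext1 q
    simp [perturb]
  have h2 := ((ContinuousLinearMap.id ℝ ℝ).smulRight c).norm_iteratedFDeriv_comp_left
    (hη.contDiffAt (x := p)) (n := j) (mod_cast le_top)
  have h3 : ‖(ContinuousLinearMap.id ℝ ℝ).smulRight c‖ ≤ 1 := by
    rw [ContinuousLinearMap.norm_smulRight_apply]
    exact mul_le_one₀ ContinuousLinearMap.norm_id_le (norm_nonneg _) hc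
  rw [h1]
  calc _ ≤ _ := h2
    _ ≤ 1 * ‖iteratedFDeriv ℝ j η p‖ := by gcongr
    _ < ε p := by rw [one_mul]; exact h p j hj

/-- The critical values of `X / η`. -/
def criticalValues (X : SmoothVectorField) (η : Plane → ℝ) : Set Plane :=
  (fun p => (η p)⁻¹ • X p) '' {p | (fderiv ℝ (fun p => (η p)⁻¹ • X p) p).det = 0}

theorem differentiable_inv_smul (X : SmoothVectorField) {η : Plane → ℝ} (hη : ContDiff ℝ ∞ η)
    (hη0 : ∀ p, 0 < η p) : Differentiable ℝ fun p => (η p)⁻¹ • X p :=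
  ((hη.differentiable (by simp)).inv fun p => (hη0 p).ne').smul X.differentiable

theorem volume_criticalValues (X : SmoothVectorField) {η : Plane → ℝ} (hη : ContDiff ℝ ∞ η)
    (hη0 : ∀ p, 0 < η p) : MeasureTheory.volume (X.criticalValues η) = 0 :=
  MeasureTheory.addHaar_image_eq_zero_of_det_fderivWithin_eq_zero _
    (fun p _ => (X.differentiable_inv_smul hη hη0 p).hasFDerivAt.hasFDerivWithinAt)
    fun _ hp => hp

theorem perturb_eq_zero_iff (X : SmoothVectorField) {η : Plane → ℝ} (hη : ContDiff ℝ ∞ η)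
    (hη0 : ∀ p, 0 < η p) (c p : Plane) :
    X.perturb η hη c p = 0 ↔ (η p)⁻¹ • X p = -c := by
  change X p + η p • c = 0 ↔ _
  rw [inv_smul_eq_iff₀ (hη0 p).ne', smul_neg, eq_neg_iff_add_eq_zero]

/-- Write the field as `η (X / η + c)`. At a zero the second factor vanishes, so the product rule
leaves only `η D(X / η)`, invertible because `-c` is a regular value. -/
theorem hasSimpleZeros_perturb (X : SmoothVectorField) {η : Plane → ℝ} (hη : ContDiff ℝ ∞ η)
    (hη0 : ∀ p, 0 < η p) {c : Plane} (hc : -c ∉ X.criticalValues η) :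
    (X.perturb η hη c).HasSimpleZeros := by
  intro p hp
  rw [perturb_eq_zero_iff X hη hη0] at hp
  have hf := (X.differentiable_inv_smul hη hη0 p).hasFDerivAt
  have hd : (fderiv ℝ (fun p => (η p)⁻¹ • X p) p).det ≠ 0 := fun h => hc ⟨p, h, hp⟩
  have hη' := (hη.differentiable (by simp) p).hasFDerivAt
  have h1 := hη'.smul (hf.add_const c)
  have h2 : (fun q => η q • ((η q)⁻¹ • X q + c)) = X.perturb η hη c := by
    ext1 q
    rw [smul_add, smul_inv_smul₀ (hη0 q).ne']
    rfl
  have h3 : HasFDerivAt (X.perturb η hη c) (η p • fderiv ℝ (fun p => (η p)⁻¹ • X p) p) p := by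
    rw [← h2]
    rw [hp, neg_add_cancel, ContinuousLinearMap.smulRight_zero, add_zero] at h1
    exact h1
  rw [h3.fderiv]
  change LinearMap.det (η p • (fderiv ℝ (fun p => (η p)⁻¹ • X p) p : Plane →ₗ[ℝ] Plane)) ≠ 0
  rw [LinearMap.det_smul]
  exact mul_ne_zero (pow_ne_zero _ (hη0 p).ne') hd

theorem HasSimpleZeros.eventually_ne_zero {X : SmoothVectorField} (hX : X.HasSimpleZeros)
    (p : Plane) : ∀ᶠ q in nhdsWithin p {p}ᶜ, X q ≠ 0 := by
  by_cases hp : X p = 0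
  · have hu : IsUnit (fderiv ℝ X p : Plane →ₗ[ℝ] Plane).det := isUnit_iff_ne_zero.2 (hX p hp)
    let e := (LinearMap.equivOfIsUnitDet hu).toContinuousLinearEquiv
    have he : ⇑e = fderiv ℝ X p := by
      ext1 z
      simp [e]
    exact (X.differentiable p).hasFDerivAt.eventually_ne ⟨_, he ▸ e.antilipschitz⟩
  · exact nhdsWithin_le_nhds (X.smooth.continuous.continuousAt.eventually_ne hp)

/-- Simple zeros are isolated, and a discrete subset of a second countable space is countable. -/
theorem HasSimpleZeros.countable_zeroSet {X : SmoothVectorField} (hX : X.HasSimpleZeros) :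
    X.zeroSet.Countable := by
  have h : ∀ p ∈ X.zeroSet, ({p} : Set Plane) ∈ nhdsWithin p X.zeroSet := by
    intro p hp
    have := hX.eventually_ne_zero p
    rw [eventually_nhdsWithin_iff] at this
    rw [mem_nhdsWithin_iff_eventually]
    filter_upwards [this] with q hq hq0
    by_contra hqp
    exact hq hqp hq0
  obtain ⟨t, -, ht, htz⟩ := TopologicalSpace.countable_cover_nhdsWithin h
  refine ht.mono fun p hp => ?_
  simpa using htz hp

theorem exists_norm_le_one_notMem {N : Set Plane} (hN : MeasureTheory.volume N = 0) :
    ∃ c : Plane, ‖c‖ ≤ 1 ∧ -c ∉ N := by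
  by_contra! h
  have hsub : Metric.ball (0 : Plane) 1 ⊆ N := fun c hc => by
    have := h (-c) (by rw [norm_neg]; exact (mem_ball_zero_iff.1 hc).le)
    rwa [neg_neg] at this
  exact (Metric.measure_ball_pos MeasureTheory.volume (0 : Plane) one_pos).ne'
    (MeasureTheory.measure_mono_null hsub hN)

/-- The pairs of vector fields that have simple zeros and no common zero. -/
def regularPairs : Set (SmoothVectorField × SmoothVectorField) :=
  {P | P.1.HasSimpleZeros ∧ P.2.HasSimpleZeros ∧ ∀ p, P.1 p = 0 → P.2 p ≠ 0}

theorem isOpen_regularPairs : IsOpen regularPairs :=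
  (isOpen_hasSimpleZeros.preimage continuous_fst).inter
    ((isOpen_hasSimpleZeros.preimage continuous_snd).inter isOpen_no_common_zero)

theorem dense_regularPairs : Dense regularPairs := by
  rw [dense_iff_inter_open]
  rintro W hW ⟨⟨X, Y⟩, hXY⟩
  obtain ⟨U, V, hU, hV, hXU, hYV, hUV⟩ := isOpen_prod_iff.1 hW X Y hXY
  obtain ⟨ε, hε, hε0, hεU⟩ := hU X hXU
  obtain ⟨δ, hδ, hδ0, hδV⟩ := hV Y hYV
  obtain ⟨η, hη, hη0, hηε⟩ := exists_contDiff_pos_iteratedFDeriv_lt hε hε0 2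
  obtain ⟨ζ, hζ, hζ0, hζδ⟩ := exists_contDiff_pos_iteratedFDeriv_lt hδ hδ0 2
  obtain ⟨c, hc1, hc⟩ := exists_norm_le_one_notMem (X.volume_criticalValues hη hη0)
  have hX' := X.hasSimpleZeros_perturb hη hη0 hc
  -- A common zero `p` would give `-d = Y p / ζ p` with `p` a zero of the perturbed first field;
  -- these values form a countable, hence null, set.
  obtain ⟨d, hd1, hd⟩ := exists_norm_le_one_notMem
    (MeasureTheory.measure_union_null (Y.volume_criticalValues hζ hζ0)
      ((hX'.countable_zeroSet.image fun p => (ζ p)⁻¹ • Y p).measure_zero MeasureTheory.volume))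
  rw [Set.mem_union, not_or] at hd
  refine ⟨(X.perturb η hη c, Y.perturb ζ hζ d),
    hUV ⟨hεU (X.perturb_mem_whitneyNhd hη hηε hc1), hδV (Y.perturb_mem_whitneyNhd hζ hζδ hd1)⟩,
    hX', Y.hasSimpleZeros_perturb hζ hζ0 hd.1, fun p hp hq => hd.2 ⟨p, hp, ?_⟩⟩
  exact (Y.perturb_eq_zero_iff hζ hζ0 d p).1 hq

end SmoothVectorField

/-! ### Complex coordinates -/

/-- The identification of the plane with `ℂ`. -/
noncomputable def toComplex : Plane ≃ₗᵢ[ℝ] ℂ := Complex.orthonormalBasisOneI.repr.symm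

theorem toComplex_apply (v : Plane) : toComplex v = ⟨v 0, v 1⟩ := by
  rw [toComplex, Complex.orthonormalBasisOneI_repr_symm_apply]
  apply Complex.ext <;> simp

theorem angle_eq (v : Plane) : angle v = (toComplex v).arg := by
  rw [toComplex_apply]
  rfl

theorem toComplex_cos_sin (t : ℝ) :
    toComplex !₂[Real.cos t, Real.sin t] = Complex.exp (t * Complex.I) := by
  rw [toComplex_apply]
  apply Complex.ext <;> simp [Complex.exp_ofReal_mul_I_re, Complex.exp_ofReal_mul_I_im]

theorem toComplex_circlePoint_sub (p : Plane) (r t : ℝ) :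
    toComplex (OrientationField.circlePoint p r t - p) = r * Complex.exp (t * Complex.I) := by
  rw [OrientationField.circlePoint, add_sub_cancel_left, map_smul, toComplex_cos_sin,
    Complex.real_smul]

theorem norm_circlePoint_sub (p : Plane) (r t : ℝ) :
    ‖OrientationField.circlePoint p r t - p‖ = |r| := by
  rw [← toComplex.norm_map, toComplex_circlePoint_sub, norm_mul,
    Complex.norm_exp_ofReal_mul_I, mul_one, Complex.norm_real, Real.norm_eq_abs]

theorem continuous_circlePoint (p : Plane) (r : ℝ) :
    Continuous (OrientationField.circlePoint p r) := by
  have : OrientationField.circlePoint p r =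
      fun t : ℝ => p + toComplex.symm (r * Complex.exp (t * Complex.I)) := by
    ext1 t
    rw [← toComplex_circlePoint_sub p r t, LinearIsometryEquiv.symm_apply_apply]
    abel
  rw [this]
  fun_prop

theorem circlePoint_two_pi (p : Plane) (r : ℝ) :
    OrientationField.circlePoint p r (2 * Real.pi) = OrientationField.circlePoint p r 0 := by
  simp [OrientationField.circlePoint]

/-- A real linear map of the plane in complex coordinates. -/
theorem exists_toComplex_clm_apply (A : Plane →L[ℝ] Plane) : ∃ α β : ℂ,
    (∀ v, toComplex (A v) = α * toComplex v + β * (starRingEnd ℂ) (toComplex v)) ∧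
      A.det = ‖α‖ ^ 2 - ‖β‖ ^ 2 := by
  let e : Fin 2 → Plane := fun i => EuclideanSpace.single i 1
  have hv : ∀ v : Plane, v = v 0 • e 0 + v 1 • e 1 := by
    intro v
    ext i
    fin_cases i <;> simp [e]
  have hA : ∀ v i, A v i = v 0 * A (e 0) i + v 1 * A (e 1) i := by
    intro v i
    conv_lhs => rw [hv v]
    simp
  -- The Wirtinger coefficients `∂` and `∂̄` of `A`.
  refine ⟨⟨(A (e 0) 0 + A (e 1) 1) / 2, (A (e 0) 1 - A (e 1) 0) / 2⟩,
    ⟨(A (e 0) 0 - A (e 1) 1) / 2, (A (e 0) 1 + A (e 1) 0) / 2⟩, fun v => ?_, ?_⟩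
  · rw [toComplex_apply, toComplex_apply]
    apply Complex.ext
    · simp only [hA v, Complex.add_re, Complex.mul_re, Complex.conj_re, Complex.conj_im]
      ring
    · simp only [hA v, Complex.add_im, Complex.mul_im, Complex.conj_re, Complex.conj_im]
      ring
  · have h : A.det = A (e 0) 0 * A (e 1) 1 - A (e 1) 0 * A (e 0) 1 := by
      change LinearMap.det (A : Plane →ₗ[ℝ] Plane) = _
      rw [← LinearMap.det_toMatrix (EuclideanSpace.basisFun (Fin 2) ℝ).toBasis,
        Matrix.det_fin_two]
      simp [LinearMap.toMatrix_apply, e]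
    rw [h, Complex.sq_norm, Complex.sq_norm, Complex.normSq_mk, Complex.normSq_mk]
    ring

/-- Near a simple zero, a vector field is dominated by a nonzero complex linear or antilinear
map. -/
theorem eventually_norm_sub_lt {F : Plane → Plane} {A : Plane →L[ℝ] Plane} {p : Plane}
    (hF : HasFDerivAt F A p) (hp : F p = 0) (hA : A.det ≠ 0) :
    (∃ α : ℂ, ∀ᶠ q in nhdsWithin p {p}ᶜ,
      ‖toComplex (F q) - α * toComplex (q - p)‖ < ‖α * toComplex (q - p)‖) ∨
    ∃ β : ℂ, ∀ᶠ q in nhdsWithin p {p}ᶜ,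
      ‖toComplex (F q) - β * (starRingEnd ℂ) (toComplex (q - p))‖ <
        ‖β * (starRingEnd ℂ) (toComplex (q - p))‖ := by
  obtain ⟨α, β, hαβ, hdet⟩ := exists_toComplex_clm_apply A
  have key : ∀ κ > 0, ∀ᶠ q in nhdsWithin p {p}ᶜ, 0 < ‖q - p‖ ∧
      ‖toComplex (F q) - (α * toComplex (q - p) + β * (starRingEnd ℂ) (toComplex (q - p)))‖ ≤
        κ * ‖q - p‖ := by
    intro κ hκ
    filter_upwards [nhdsWithin_le_nhds ((hasFDerivAt_iff_isLittleO.1 hF).def hκ),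
      self_mem_nhdsWithin] with q hq hqp
    refine ⟨norm_pos_iff.2 (sub_ne_zero.2 hqp), ?_⟩
    rwa [← hαβ, ← map_sub, toComplex.norm_map, ← sub_zero (F q), ← hp]
  have hne : ‖α‖ ≠ ‖β‖ := by
    intro h
    rw [h, sub_self] at hdet
    exact hA hdet
  rcases lt_or_gt_of_ne hne with h | h
  · right
    refine ⟨β, ?_⟩
    -- With half of the gap as error, remainder plus smaller term stay below `‖β‖ ‖q - p‖`.
    filter_upwards [key ((‖β‖ - ‖α‖) / 2) (by linarith)] with q ⟨hq0, hq⟩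
    have h1 : toComplex (F q) - β * (starRingEnd ℂ) (toComplex (q - p)) =
        (toComplex (F q) - (α * toComplex (q - p) + β * (starRingEnd ℂ) (toComplex (q - p)))) +
          α * toComplex (q - p) := by ring
    have h2 := norm_add_le
      (toComplex (F q) - (α * toComplex (q - p) + β * (starRingEnd ℂ) (toComplex (q - p))))
      (α * toComplex (q - p))
    rw [← h1, norm_mul α, toComplex.norm_map] at h2
    rw [norm_mul β, RCLike.norm_conj, toComplex.norm_map]
    nlinarith
  · left
    refine ⟨α, ?_⟩
    filter_upwards [key ((‖α‖ - ‖β‖) / 2) (by linarith)] with q ⟨hq0, hq⟩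
    have h1 : toComplex (F q) - α * toComplex (q - p) =
        (toComplex (F q) - (α * toComplex (q - p) + β * (starRingEnd ℂ) (toComplex (q - p)))) +
          β * (starRingEnd ℂ) (toComplex (q - p)) := by ring
    have h2 := norm_add_le
      (toComplex (F q) - (α * toComplex (q - p) + β * (starRingEnd ℂ) (toComplex (q - p))))
      (β * (starRingEnd ℂ) (toComplex (q - p)))
    rw [← h1, norm_mul β, RCLike.norm_conj, toComplex.norm_map] at h2
    rw [norm_mul α, toComplex.norm_map]
    nlinarith

/-! ### Variation of the argument -/

/-- The curve `f : [0, 2π] → ℂ` avoids `0`, and a continuous choice of its argument varies by `a`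
in total. -/
def HasArgVariation (f : ℝ → ℂ) (a : ℝ) : Prop :=
  ∃ φ : ℝ → ℝ, ContinuousOn φ (Set.Icc 0 (2 * Real.pi)) ∧
    (∀ t ∈ Set.Icc (0 : ℝ) (2 * Real.pi), f t ≠ 0 ∧ ((f t).arg : Real.Angle) = φ t) ∧
    φ (2 * Real.pi) - φ 0 = a

/-- Two closed curves have the same variation of the argument if one of them stays closer to the
other one than the origin does. -/
theorem HasArgVariation.of_norm_sub_lt {f g : ℝ → ℂ} {a : ℝ} (hg : HasArgVariation g a)
    (hfc : Continuous f) (hgc : Continuous g) (hf2 : f (2 * Real.pi) = f 0)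
    (hg2 : g (2 * Real.pi) = g 0) (h : ∀ t, ‖f t - g t‖ < ‖g t‖) : HasArgVariation f a := by
  obtain ⟨φ, hφ, hφg, hφa⟩ := hg
  have hg0 : ∀ t, g t ≠ 0 := fun t => norm_pos_iff.1 ((norm_nonneg _).trans_lt (h t))
  -- The quotient stays in the unit disc about `1`, where the principal argument is continuous;
  -- adding it to `φ` lifts the argument of `f`, and it takes equal values at both ends.
  have hs : ∀ t, f t / g t ∈ Complex.slitPlane := by
    intro t
    have h1 : ‖f t / g t - 1‖ < 1 := by
      rw [div_sub_one (hg0 t), norm_div, div_lt_one (norm_pos_iff.2 (hg0 t))]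
      exact h t
    left
    have := (abs_lt.1 ((Complex.abs_re_le_norm _).trans_lt h1)).1
    rw [Complex.sub_re, Complex.one_re] at this
    linarith
  refine ⟨fun t => φ t + (f t / g t).arg, hφ.add (Continuous.continuousOn ?_), fun t ht => ?_, ?_⟩
  · exact continuous_iff_continuousAt.2 fun t =>
      ContinuousAt.comp (f := fun t => f t / g t) (Complex.continuousAt_arg (hs t))
        (hfc.div hgc hg0).continuousAt
  · have hfg : f t = g t * (f t / g t) := (mul_div_cancel₀ _ (hg0 t)).symm
    have hne := Complex.slitPlane_ne_zero (hs t)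
    refine ⟨fun h0 => hne (by rw [h0, zero_div]), ?_⟩
    rw [Real.Angle.coe_add, ← (hφg t ht).2, ← Complex.arg_mul_coe_angle (hg0 t) hne, ← hfg]
  · simp only [hf2, hg2]
    linarith

theorem hasArgVariation_const {z : ℂ} (hz : z ≠ 0) : HasArgVariation (fun _ => z) 0 :=
  ⟨fun _ => z.arg, continuousOn_const, fun _ _ => ⟨hz, rfl⟩, sub_self _⟩

theorem arg_exp_mul_I_coe_angle (t : ℝ) :
    ((Complex.exp (t * Complex.I)).arg : Real.Angle) = t := by
  simpa [Complex.exp_mul_I] using Complex.arg_cos_add_sin_mul_I_coe_angle (t : Real.Angle)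

theorem hasArgVariation_circle {z : ℂ} (hz : z ≠ 0) :
    HasArgVariation (fun t => z * Complex.exp (t * Complex.I)) (2 * Real.pi) := by
  refine ⟨fun t => z.arg + t, by fun_prop, fun t _ =>
    ⟨mul_ne_zero hz (Complex.exp_ne_zero _), ?_⟩, by ring⟩
  rw [Complex.arg_mul_coe_angle hz (Complex.exp_ne_zero _), Real.Angle.coe_add,
    arg_exp_mul_I_coe_angle]

theorem hasArgVariation_conj_circle {z : ℂ} (hz : z ≠ 0) :
    HasArgVariation (fun t => z * Complex.exp (-t * Complex.I)) (-(2 * Real.pi)) := by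
  refine ⟨fun t => z.arg + -t, by fun_prop, fun t _ =>
    ⟨mul_ne_zero hz (Complex.exp_ne_zero _), ?_⟩, by ring⟩
  rw [Complex.arg_mul_coe_angle hz (Complex.exp_ne_zero _), Real.Angle.coe_add,
    ← Complex.ofReal_neg, arg_exp_mul_I_coe_angle]

/-- A property that holds near `p` except possibly at `p` holds on all small circles. -/
theorem exists_forall_circlePoint {P : Plane → Prop} {p : Plane}
    (h : ∀ᶠ q in nhdsWithin p {p}ᶜ, P q) :
    ∃ ρ : ℝ, 0 < ρ ∧ ∀ r : ℝ, 0 < r → r < ρ → ∀ t, P (OrientationField.circlePoint p r t) := by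
  rw [eventually_nhdsWithin_iff] at h
  obtain ⟨ρ, hρ, hP⟩ := Metric.eventually_nhds_iff.1 h
  refine ⟨ρ, hρ, fun r hr0 hr t => hP ?_ fun hq => ?_⟩
  · rwa [dist_eq_norm, norm_circlePoint_sub, abs_of_pos hr0]
  · have := norm_circlePoint_sub p r t
    rw [Set.mem_singleton_iff.1 hq, sub_self, norm_zero, abs_of_pos hr0] at this
    exact hr0.ne this

/-- The vector field `X` has variation of the argument `a` on all small circles around `p`. -/
def HasArgVariationAt (X : Plane → Plane) (p : Plane) (a : ℝ) : Prop :=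
  ∃ ρ : ℝ, 0 < ρ ∧ ∀ r : ℝ, 0 < r → r < ρ →
    HasArgVariation (fun t => toComplex (X (OrientationField.circlePoint p r t))) a

theorem hasArgVariationAt_of_ne_zero {X : Plane → Plane} (hX : Continuous X) {p : Plane}
    (hp : X p ≠ 0) : HasArgVariationAt X p 0 := by
  have hp' : toComplex (X p) ≠ 0 := fun h => hp (by simpa using h)
  have h : ∀ᶠ q in nhdsWithin p {p}ᶜ,
      ‖toComplex (X q) - toComplex (X p)‖ < ‖toComplex (X p)‖ := by
    refine nhdsWithin_le_nhds ?_
    have hc : Continuous fun q => ‖toComplex (X q) - toComplex (X p)‖ := by fun_prop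
    refine (hc.tendsto p).eventually_lt_const ?_
    rw [sub_self, norm_zero]
    exact norm_pos_iff.2 hp'
  obtain ⟨ρ, hρ, H⟩ := exists_forall_circlePoint h
  refine ⟨ρ, hρ, fun r hr0 hr => (hasArgVariation_const hp').of_norm_sub_lt ?_ continuous_const
    ?_ rfl (H r hr0 hr)⟩
  · have := continuous_circlePoint p r
    fun_prop
  · simp only [circlePoint_two_pi]

theorem hasArgVariationAt_of_simple_zero {X : Plane → Plane} (hX : Continuous X)
    {A : Plane →L[ℝ] Plane} {p : Plane} (hXA : HasFDerivAt X A p) (hp : X p = 0)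
    (hA : A.det ≠ 0) :
    HasArgVariationAt X p (2 * Real.pi) ∨ HasArgVariationAt X p (-(2 * Real.pi)) := by
  have hc : ∀ r, Continuous fun t => toComplex (X (OrientationField.circlePoint p r t)) := by
    intro r
    have := continuous_circlePoint p r
    fun_prop
  rcases eventually_norm_sub_lt hXA hp hA with ⟨α, hα⟩ | ⟨α, hα⟩ <;>
    obtain ⟨ρ, hρ, H⟩ := exists_forall_circlePoint hα
  · refine Or.inl ⟨ρ, hρ, fun r hr0 hr => ?_⟩
    have hz : ∀ t : ℝ, α * toComplex (OrientationField.circlePoint p r t - p) =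
        α * r * Complex.exp (t * Complex.I) := fun t => by
      rw [toComplex_circlePoint_sub, mul_assoc]
    have H' := H r hr0 hr
    simp only [hz] at H'
    have h0 : α * r ≠ 0 := fun h => by
      have := (norm_nonneg _).trans_lt (H' 0)
      rw [h] at this
      simp at this
    refine (hasArgVariation_circle h0).of_norm_sub_lt (hc r) (by fun_prop) ?_ ?_ H'
    · simp only [circlePoint_two_pi]
    · rw [← hz, ← hz, circlePoint_two_pi]
  · refine Or.inr ⟨ρ, hρ, fun r hr0 hr => ?_⟩
    have hz : ∀ t : ℝ, α * (starRingEnd ℂ) (toComplex (OrientationField.circlePoint p r t - p)) =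
        α * r * Complex.exp (-t * Complex.I) := fun t => by
      rw [toComplex_circlePoint_sub, map_mul, Complex.conj_ofReal, ← Complex.exp_conj, map_mul,
        Complex.conj_ofReal, Complex.conj_I, mul_assoc, mul_neg, neg_mul]
    have H' := H r hr0 hr
    simp only [hz] at H'
    have h0 : α * r ≠ 0 := fun h => by
      have := (norm_nonneg _).trans_lt (H' 0)
      rw [h] at this
      simp at this
    refine (hasArgVariation_conj_circle h0).of_norm_sub_lt (hc r) (by fun_prop) ?_ ?_ H'
    · simp only [circlePoint_two_pi]
    · rw [← hz, ← hz, circlePoint_two_pi]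

/-! ### Continuity and index of the bisector -/

/-- Halving of angles, from `ℝ / 2πℤ` to `ℝ / πℤ`. -/
noncomputable def halfAngle : Real.Angle ≃ₜ OrientationSet :=
  AddCircle.homeomorphAddCircle (2 * Real.pi) Real.pi Real.two_pi_pos.ne' Real.pi_ne_zero

theorem halfAngle_coe (x : ℝ) : halfAngle (x : Real.Angle) = ((x / 2 : ℝ) : OrientationSet) := by
  refine (AddCircle.homeomorphAddCircle_apply_mk (2 * Real.pi) Real.pi _ _ x).trans ?_
  congr 1
  have := Real.pi_ne_zero
  field_simp

theorem bisector_apply (X Y : SmoothVectorField) (p : (bisector X Y).domain) :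
    (bisector X Y).toFun p = halfAngle
      (((toComplex (X p)).arg : Real.Angle) + ((toComplex (Y p)).arg : Real.Angle)) := by
  rw [← Real.Angle.coe_add, halfAngle_coe, ← angle_eq, ← angle_eq]
  rfl

theorem mem_domain_bisector {X Y : SmoothVectorField} {p : Plane} :
    p ∈ (bisector X Y).domain ↔ X p ≠ 0 ∧ Y p ≠ 0 := by
  change ¬(X p = 0 ∨ Y p = 0) ↔ _
  rw [not_or]

/-- The principal argument jumps by `2π`, but its class in `Real.Angle` is continuous off `0`, and
halving `ℝ / 2πℤ → ℝ / πℤ` is a homeomorphism. -/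
theorem continuous_bisector (X Y : SmoothVectorField) : Continuous (bisector X Y).toFun := by
  have h : ∀ Z : SmoothVectorField, (∀ p ∈ (bisector X Y).domain, Z p ≠ 0) →
      Continuous fun p : (bisector X Y).domain => ((toComplex (Z p)).arg : Real.Angle) := by
    intro Z hZ
    refine continuous_iff_continuousAt.2 fun p => ?_
    have hc : Continuous fun p : (bisector X Y).domain => toComplex (Z p) :=
      toComplex.continuous.comp (Z.smooth.continuous.comp continuous_subtype_val)
    exact ContinuousAt.comp (f := fun p : (bisector X Y).domain => toComplex (Z p))
      (Complex.continuousAt_arg_coe_angle fun h0 => hZ p p.2 (by simpa using h0)) hc.continuousAt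
  have := halfAngle.continuous.comp ((h X fun p hp => (mem_domain_bisector.1 hp).1).add
    (h Y fun p hp => (mem_domain_bisector.1 hp).2))
  exact this.congr fun p => (bisector_apply X Y p).symm

theorem hasIndexAt_bisector {X Y : SmoothVectorField} {p : Plane} {a b i : ℝ}
    (hX : HasArgVariationAt X p a) (hY : HasArgVariationAt Y p b)
    (hi : (a + b) / 2 = 2 * Real.pi * i) : (bisector X Y).HasIndexAt p i := by
  obtain ⟨ρ, hρ, hX⟩ := hX
  obtain ⟨σ, hσ, hY⟩ := hY
  refine ⟨min ρ σ, lt_min hρ hσ, fun r hr0 hr => ?_⟩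
  obtain ⟨φ, hφ, hφX, hφa⟩ := hX r hr0 (hr.trans_le (min_le_left _ _))
  obtain ⟨ψ, hψ, hψY, hψb⟩ := hY r hr0 (hr.trans_le (min_le_right _ _))
  refine ⟨fun t => (φ t + ψ t) / 2, (hφ.add hψ).div_const 2, fun t ht => ?_, ?_⟩
  · have hdom : OrientationField.circlePoint p r t ∈ (bisector X Y).domain := by
      refine mem_domain_bisector.2 ⟨fun h => (hφX t ht).1 ?_, fun h => (hψY t ht).1 ?_⟩ <;>
        simp [h]
    refine ⟨hdom, ?_⟩
    rw [bisector_apply, (hφX t ht).2, (hψY t ht).2, ← Real.Angle.coe_add, halfAngle_coe]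
  · rw [← hi, ← hφa, ← hψb]
    ring

theorem isIsolatedSingularity_bisector {X Y : SmoothVectorField} (hX : X.HasSimpleZeros)
    (hY : Y.HasSimpleZeros) {p : Plane} (hp : (bisector X Y).IsSingularAt p) :
    (bisector X Y).IsIsolatedSingularity p := by
  refine ⟨hp, ?_⟩
  have h := (hX.eventually_ne_zero p).and (hY.eventually_ne_zero p)
  rw [eventually_nhdsWithin_iff] at h
  obtain ⟨V, hV, hVo, hpV⟩ := eventually_nhds_iff.1 h
  refine ⟨V, hVo, Set.Subset.antisymm (fun q hq => ?_) ?_⟩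
  · by_cases hqp : q = p
    · exact Or.inl hqp
    · exact Or.inr ⟨hq, mem_domain_bisector.2 (hV q hq hqp)⟩
  · rintro q (rfl | hq)
    · exact hpV
    · exact hq.1

/-- Only one field vanishes at `p`: it contributes `±2π` and the other `0`. -/
theorem hasIndexAt_bisector_of_mem_regularPairs {X Y : SmoothVectorField}
    (h : (X, Y) ∈ SmoothVectorField.regularPairs) {p : Plane}
    (hp : p ∉ (bisector X Y).domain) :
    (bisector X Y).HasIndexAt p (1 / 2) ∨ (bisector X Y).HasIndexAt p (-1 / 2) := by
  obtain ⟨hX, hY, hXY⟩ := h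
  have hXc := X.smooth.continuous
  have hYc := Y.smooth.continuous
  by_cases hXp : X p = 0
  · have hYv := hasArgVariationAt_of_ne_zero hYc (hXY p hXp)
    rcases hasArgVariationAt_of_simple_zero hXc (X.differentiable p).hasFDerivAt hXp
      (hX p hXp) with hv | hv
    · exact Or.inl (hasIndexAt_bisector hv hYv (by ring))
    · exact Or.inr (hasIndexAt_bisector hv hYv (by ring))
  · have hXv := hasArgVariationAt_of_ne_zero hXc hXp
    have hYp : Y p = 0 := by
      by_contra hYp
      exact hp (mem_domain_bisector.2 ⟨hXp, hYp⟩)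
    rcases hasArgVariationAt_of_simple_zero hYc (Y.differentiable p).hasFDerivAt hYp
      (hY p hYp) with hv | hv
    · exact Or.inl (hasIndexAt_bisector hXv hv (by ring))
    · exact Or.inr (hasIndexAt_bisector hXv hv (by ring))

end BisectorLineField

theorem mainTheorem2 :
    BisectorLineField.IsGeneric
      (fun P : BisectorLineField.SmoothVectorField × BisectorLineField.SmoothVectorField =>
        Continuous (BisectorLineField.bisector P.1 P.2).toFun ∧
        ∀ p : BisectorLineField.Plane,
          (BisectorLineField.bisector P.1 P.2).IsSingularAt p →
            (BisectorLineField.bisector P.1 P.2).IsIsolatedSingularity p ∧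
            ((BisectorLineField.bisector P.1 P.2).HasIndexAt p (1 / 2) ∨
              (BisectorLineField.bisector P.1 P.2).HasIndexAt p (-1 / 2))) := by
  -- A constant sequence, so density of the intersection needs no Baire argument.
  refine ⟨fun _ => BisectorLineField.SmoothVectorField.regularPairs,
    fun _ => BisectorLineField.SmoothVectorField.isOpen_regularPairs,
    fun _ => BisectorLineField.SmoothVectorField.dense_regularPairs, ?_, ?_⟩
  · rw [Set.iInter_const]
    exact BisectorLineField.SmoothVectorField.dense_regularPairs
  · rintro ⟨X, Y⟩ hP
    rw [Set.iInter_const] at hP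
    exact ⟨BisectorLineField.continuous_bisector X Y, fun p hp =>
      ⟨BisectorLineField.isIsolatedSingularity_bisector hP.1 hP.2.1 hp,
        BisectorLineField.hasIndexAt_bisector_of_mem_regularPairs hP hp.1.2⟩⟩
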